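/- Let $d\ge 1$, let $\Omega\subset\mathbb R^d$ be a bounded open set with Lipschitz boundary $\partial\Omega$, and let $T>0$. Write $\sigma$ for the surface measure on $\partial\Omega$, $(\cdot,\cdot)$ and $(\cdot,\cdot)_{\partial\Omega}$ for the inner products of $L^2(\Omega)$ and $L^2(\partial\Omega)$; functions in $H^1(\Omega)$ are evaluated on $\partial\Omega$ in the sense of traces, and $\partial_t$ is the weak time derivative. Assume: 1. $\eta:[0,T]\times\overline\Omega\to\mathbb R$ is measurable and $0<\eta_0\le\eta\le\eta_1<\infty$; 2. $\kappa:[0,T]\times\overline\Omega\to\mathbb R$ is measurable, $0<\kappa_0\le\kappa\le\kappa_1<\infty$ almost everywhere on $[0,T]\times\Omega$ and on $[0,T]\times\partial\Omega$, and $|\partial_t\kappa|\le\kappa_1'<\infty$ almost everywhere on $(0,T)\times\Omega$; 3. $F:\mathbb R\to\mathbb R$ is Lipschitz continuous; 4. $\tilde u_0\in H^1(\Omega)$; 5. $g\in H^1(0,T;L^2(\partial\Omega))$ and $G:=g/\kappa\in H^1(0,T;L^2(\partial\Omega))$; 6. $p\in C([0,T];L^2(\Omega))$ and $\omega(t):=\int_\Omega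 p(t,x)\,dx\neq0$ for all $t\in[0,T]$; 7. $m\in H^1(0,T)$. Then there is at most one pair $\{u,h\}$ with $h\in L^2(0,T)$, $u\in C([0,T];H^1(\Omega))$ and $\partial_t u\in L^2(0,T;H^1(\Omega))$ such that $u(0)=\tilde u_0$, such that for almost every $t\in(0,T)$ $$h(t)=\frac1{\omega(t)}\Big[m'(t)-\int_{\partial\Omega}\eta(t)\,\partial_tG(t)\,d\sigma-\int_{\partial\Omega}g(t)\,d\sigma-\int_\Omega F(u(t,x))\,dx\Big],$$ and such that for almost every $t\in(0,T)$ and every $\varphi\in H^1(\Omega)$ $$(\partial_tu(t),\varphi)+(\eta(t)\nabla\partial_tu(t),\nabla\varphi)+(\kappa(t)\nabla u(t),\nabla\varphi)=h(t)(p(t),\varphi)+(F(u(t)),\varphi)+(\eta(t)\,\partial_tG(t),\varphi)_{\partial\Omega}+(g(t),\varphi)_{\partial\Omega}.$$ That is, if $\{u_1,h_1\}$ and $\{u_2,h_2\}$ are two such pairs, then $u_1(t)=u_2(t)$ in $H^1(\Omega)$ for all $t\in[0,T]$ and $h_1=h_2$ almost everywhere in $(0,T)$. -/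

import Mathlib

open MeasureTheory Set
open scoped ContDiff

noncomputable section

namespace PseudoParabolic

/-- `ℝᵈ` with its Euclidean norm. -/
abbrev E (d : ℕ) : Type := EuclideanSpace ℝ (Fin d)

variable {d : ℕ}

/-- `Ω` has a Lipschitz boundary: near each boundary point, after a rigid motion, `Ω` is the
region strictly above the graph of a Lipschitz function of `d - 1` variables. -/
def HasLipschitzBoundary (Ω : Set (E d)) : Prop :=
  ∀ x₀ ∈ frontier Ω, ∃ (Φ : E d ≃ᵢ WithLp 2 (E (d - 1) × ℝ)) (γ : E (d - 1) → ℝ)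
    (L : NNReal) (r : ℝ), LipschitzWith L γ ∧ 0 < r ∧
      ∀ x ∈ Metric.ball x₀ r, x ∈ Ω ↔ γ (Φ x).fst < (Φ x).snd

/-- The Lebesgue measure on `Ω`. -/
abbrev vol (Ω : Set (E d)) : Measure (E d) := volume.restrict Ω

/-- The surface measure on `∂Ω`, i.e. the `(d-1)`-dimensional Hausdorff measure (normalised so
as to extend the Lebesgue measure). -/
abbrev surf (Ω : Set (E d)) : Measure (E d) :=
  (Measure.euclideanHausdorffMeasure (d - 1)).restrict (frontier Ω)

/-- `V` is the gradient of `u` in `Ω` in the sense of distributions. -/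
def IsWeakGradient (Ω : Set (E d)) (u : E d → ℝ) (V : E d → E d) : Prop :=
  ∀ φ : E d → ℝ, ContDiff ℝ ∞ φ → HasCompactSupport φ → tsupport φ ⊆ Ω → ∀ i : Fin d,
    ∫ x in Ω, u x * fderiv ℝ φ x (EuclideanSpace.single i 1) = - ∫ x in Ω, V x i * φ x

lemma integral_inner_toLp {F : Type*} [NormedAddCommGroup F] [InnerProductSpace ℝ F]
    {μ : Measure (E d)} {ψ : E d → F} (hψ : MemLp ψ 2 μ) (f : Lp F 2 μ) :
    ∫ x, inner ℝ (ψ x) (f x) ∂μ = inner ℝ (hψ.toLp ψ) f := by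
  rw [L2.inner_def]
  refine integral_congr_ae ?_
  filter_upwards [hψ.coeFn_toLp] with x hx
  rw [hx]

/-- The weak gradient identity for a fixed test function says that a continuous linear functional
vanishes. -/
lemma exists_functional (Ω : Set (E d)) {φ : E d → ℝ} (h1 : ContDiff ℝ ∞ φ)
    (h2 : HasCompactSupport φ) (i : Fin d) :
    ∃ ℓ : WithLp 2 (Lp ℝ 2 (vol Ω) × Lp (E d) 2 (vol Ω)) →L[ℝ] ℝ, ∀ w,
      ℓ w = (∫ x in Ω, w.fst x * fderiv ℝ φ x (EuclideanSpace.single i 1)) +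
        ∫ x in Ω, w.snd x i * φ x := by
  have hA : MemLp (fun x => fderiv ℝ φ x (EuclideanSpace.single i 1)) 2 (vol Ω) := by
    refine Continuous.memLp_of_hasCompactSupport ?_ ?_
    · exact (h1.continuous_fderiv (by simp)).clm_apply continuous_const
    · exact h2.fderiv_apply (𝕜 := ℝ) _
  have hB : MemLp (fun x => φ x • (EuclideanSpace.single i 1 : E d)) 2 (vol Ω) := by
    refine Continuous.memLp_of_hasCompactSupport ?_ ?_
    · exact h1.continuous.smul continuous_const
    · exact h2.smul_right
  refine ⟨(innerSL ℝ (hA.toLp _)).comp (WithLp.fstL 2 ℝ _ _) +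
    (innerSL ℝ (hB.toLp _)).comp (WithLp.sndL 2 ℝ _ _), fun w => ?_⟩
  have e1 := integral_inner_toLp hA w.fst
  have e2 := integral_inner_toLp hB w.snd
  have e3 : ∀ x, inner ℝ (φ x • (EuclideanSpace.single i 1 : E d)) (w.snd x) =
      w.snd x i * φ x := fun x => by
    rw [inner_smul_left, EuclideanSpace.inner_single_left]; simp [mul_comm]
  simp only [e3] at e2
  rw [e2]
  simp only [add_apply, ContinuousLinearMap.comp_apply, innerSL_apply_apply]
  congr 1
  exact e1.symm

/-- The Sobolev space `H¹(Ω)`, realised as the space of pairs `(u, ∇u)` in `L²(Ω) × L²(Ω)ᵈ`; its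
norm is `(‖u‖² + ‖∇u‖²)^(1/2)`. -/
def H1 (Ω : Set (E d)) : Submodule ℝ (WithLp 2 (Lp ℝ 2 (vol Ω) × Lp (E d) 2 (vol Ω))) where
  carrier := {w | IsWeakGradient Ω w.fst w.snd}
  add_mem' := by
    intro a b ha hb φ h1 h2 h3 i
    obtain ⟨ℓ, hℓ⟩ := exists_functional Ω h1 h2 i
    have ha' := ha φ h1 h2 h3 i
    have hb' := hb φ h1 h2 h3 i
    have := hℓ (a + b)
    rw [map_add, hℓ a, hℓ b] at this
    linarith
  zero_mem' := by
    intro φ h1 h2 h3 i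
    obtain ⟨ℓ, hℓ⟩ := exists_functional Ω h1 h2 i
    have := hℓ 0
    rw [map_zero] at this
    linarith
  smul_mem' := by
    intro c a ha φ h1 h2 h3 i
    obtain ⟨ℓ, hℓ⟩ := exists_functional Ω h1 h2 i
    have ha' := ha φ h1 h2 h3 i
    have := hℓ (c • a)
    rw [map_smul, hℓ a, ha', neg_add_cancel, smul_zero] at this
    linarith

/-- `H¹(Ω)` is complete. -/
instance instCompleteSpaceH1 (Ω : Set (E d)) : CompleteSpace (H1 Ω) := by
  refine IsClosed.completeSpace_coe (hs := ?_)
  refine isClosed_of_closure_subset fun w hw φ h1 h2 h3 i => ?_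
  obtain ⟨ℓ, hℓ⟩ := exists_functional Ω h1 h2 i
  have : w ∈ {w | ℓ w = 0} := by
    refine closure_minimal ?_ (isClosed_eq ℓ.continuous continuous_const) hw
    intro a ha
    have ha' := ha φ h1 h2 h3 i
    simp only [mem_ofPred_eq, hℓ a, ha', neg_add_cancel]
  have h0 : ℓ w = 0 := this
  rw [hℓ w] at h0
  linarith

/-- The function underlying an element of `H¹(Ω)`. -/
def fn {Ω : Set (E d)} (v : H1 Ω) : Lp ℝ 2 (vol Ω) := v.1.fst

/-- The weak gradient of an element of `H¹(Ω)`. -/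
def grad {Ω : Set (E d)} (v : H1 Ω) : Lp (E d) 2 (vol Ω) := v.1.snd

/-- `S` is a bounded operator `H¹(Ω) → L²(∂Ω)` that restricts smooth functions to `∂Ω`. -/
def IsTraceOperator (Ω : Set (E d)) (S : H1 Ω →L[ℝ] Lp ℝ 2 (surf Ω)) : Prop :=
  ∀ f : E d → ℝ, ContDiff ℝ ∞ f → HasCompactSupport f → ∀ v : H1 Ω,
    (fn v : E d → ℝ) =ᵐ[vol Ω] f → (S v : E d → ℝ) =ᵐ[surf Ω] f

open Classical in
/-- The trace operator `H¹(Ω) → L²(∂Ω)`: the bounded operator that extends the restriction of smooth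
functions to `∂Ω`. For a bounded Lipschitz `Ω` it exists and is unique (the default value `0` is
used only if there is no such operator). -/
def trace (Ω : Set (E d)) : H1 Ω →L[ℝ] Lp ℝ 2 (surf Ω) :=
  if h : ∃ S, IsTraceOperator Ω S then h.choose else 0

section Time

variable {X : Type*} [NormedAddCommGroup X] [NormedSpace ℝ X]

/-- `v ∈ L²(0,T;X)` (Bochner). -/
def MemL2Time (T : ℝ) (v : ℝ → X) : Prop := MemLp v 2 (volume.restrict (Ioo 0 T))

/-- `v'` is the weak (distributional) derivative of `v` on `(0,T)`. -/
def HasWeakTimeDeriv (T : ℝ) (v v' : ℝ → X) : Prop :=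
  ∀ ψ : ℝ → ℝ, ContDiff ℝ ∞ ψ → HasCompactSupport ψ → tsupport ψ ⊆ Ioo 0 T →
    ∫ t in Ioo 0 T, deriv ψ t • v t = - ∫ t in Ioo 0 T, ψ t • v' t

/-- `v` has a weak derivative in `L²(0,T;X)`. -/
def HasL2TimeDeriv (T : ℝ) (v : ℝ → X) : Prop :=
  ∃ v' : ℝ → X, MemL2Time T v' ∧ HasWeakTimeDeriv T v v'

/-- `v ∈ H¹(0,T;X)`. -/
def MemH1Time (T : ℝ) (v : ℝ → X) : Prop := MemL2Time T v ∧ HasL2TimeDeriv T v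

open Classical in
/-- The weak derivative `∂ₜ v ∈ L²(0,T;X)`, which is determined up to equality almost everywhere
(default value `0` if there is none). -/
def dt (T : ℝ) (v : ℝ → X) : ℝ → X :=
  if h : HasL2TimeDeriv T v then h.choose else 0

end Time

/-- The given data. The values of `η` and `κ` matter only on `[0,T] × closure Ω`, those of `p`,
`g` and `m` only on `[0,T]`. -/
structure Data (Ω : Set (E d)) where
  /-- final time -/
  T : ℝ
  /-- coefficient of `∇ ∂ₜ u` -/
  η : ℝ → E d → ℝ
  /-- coefficient of `∇ u` -/
  κ : ℝ → E d → ℝ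
  /-- the nonlinearity -/
  F : ℝ → ℝ
  /-- the initial value -/
  u₀ : H1 Ω
  /-- the Neumann datum -/
  g : ℝ → Lp ℝ 2 (surf Ω)
  /-- the known factor of the source -/
  p : ℝ → Lp ℝ 2 (vol Ω)
  /-- the measurement -/
  m : ℝ → ℝ

namespace Data

variable {Ω : Set (E d)} (D : Data Ω)

open Classical in
/-- `G = g / κ` on the boundary, as a function of time with values in `L²(∂Ω)`. -/
def G (t : ℝ) : Lp ℝ 2 (surf Ω) :=
  if h : MemLp (fun x => D.g t x / D.κ t x) 2 (surf Ω) then h.toLp _ else 0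

/-- `ω(t) = ∫_Ω p(t,x) dx`. -/
def omega (t : ℝ) : ℝ := ∫ x in Ω, D.p t x

/-- The measure `dt ⊗ dx` on `[0,T] × Ω`. -/
def cylinder : Measure (ℝ × E d) := (volume.restrict (Icc 0 D.T)).prod (vol Ω)

/-- The measure `dt ⊗ dσ` on `[0,T] × ∂Ω`. -/
def lateral : Measure (ℝ × E d) := (volume.restrict (Icc 0 D.T)).prod (surf Ω)

/-- `κ'` is the weak derivative of `κ` with respect to time in `(0,T) × Ω`. -/
def IsWeakTimeDerivκ (κ' : ℝ → E d → ℝ) : Prop :=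
  ∀ ψ : ℝ × E d → ℝ, ContDiff ℝ ∞ ψ → HasCompactSupport ψ → tsupport ψ ⊆ Ioo 0 D.T ×ˢ Ω →
    ∫ z, D.κ z.1 z.2 * fderiv ℝ ψ z (1, 0) ∂D.cylinder = - ∫ z, κ' z.1 z.2 * ψ z ∂D.cylinder

/-- The standing assumptions on the data. -/
structure Admissible : Prop where
  T_pos : 0 < D.T
  η_meas : AEStronglyMeasurable (fun z : ℝ × E d => D.η z.1 z.2) D.cylinder
  η_meas_bdry : AEStronglyMeasurable (fun z : ℝ × E d => D.η z.1 z.2) D.lateral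
  η_bound : ∃ η₀ η₁ : ℝ, 0 < η₀ ∧ ∀ t ∈ Icc 0 D.T, ∀ x ∈ closure Ω, η₀ ≤ D.η t x ∧ D.η t x ≤ η₁
  κ_meas : AEStronglyMeasurable (fun z : ℝ × E d => D.κ z.1 z.2) D.cylinder
  κ_meas_bdry : AEStronglyMeasurable (fun z : ℝ × E d => D.κ z.1 z.2) D.lateral
  κ_bound : ∃ κ₀ κ₁ : ℝ, 0 < κ₀ ∧
    (∀ᵐ z ∂D.cylinder, κ₀ ≤ D.κ z.1 z.2 ∧ D.κ z.1 z.2 ≤ κ₁) ∧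
    (∀ᵐ z ∂D.lateral, κ₀ ≤ D.κ z.1 z.2 ∧ D.κ z.1 z.2 ≤ κ₁)
  κ_deriv : ∃ (κ' : ℝ → E d → ℝ) (K : ℝ),
    AEStronglyMeasurable (fun z : ℝ × E d => κ' z.1 z.2) D.cylinder ∧
    (∀ᵐ z ∂D.cylinder, |κ' z.1 z.2| ≤ K) ∧ D.IsWeakTimeDerivκ κ'
  F_lip : ∃ L : NNReal, LipschitzWith L D.F
  g_mem : MemH1Time D.T D.g
  G_mem : MemH1Time D.T D.G
  p_cont : ContinuousOn D.p (Icc 0 D.T)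
  omega_ne_zero : ∀ t ∈ Icc 0 D.T, D.omega t ≠ 0
  m_mem : MemH1Time D.T D.m

/-- The expression of `h(t)` in terms of `u(t)` and the data. -/
def hExpr (u : ℝ → H1 Ω) (t : ℝ) : ℝ :=
  1 / D.omega t * (dt D.T D.m t - (∫ x, D.η t x * dt D.T D.G t x ∂surf Ω)
    - (∫ x, D.g t x ∂surf Ω) - ∫ x in Ω, D.F (fn (u t) x))

/-- The variational identity at time `t` with test function `φ`. -/
def VarEq (u : ℝ → H1 Ω) (h : ℝ → ℝ) (t : ℝ) (φ : H1 Ω) : Prop :=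
  (∫ x in Ω, fn (dt D.T u t) x * fn φ x)
    + (∫ x in Ω, D.η t x * inner ℝ (grad (dt D.T u t) x) (grad φ x))
    + (∫ x in Ω, D.κ t x * inner ℝ (grad (u t) x) (grad φ x))
  = h t * (∫ x in Ω, D.p t x * fn φ x)
    + (∫ x in Ω, D.F (fn (u t) x) * fn φ x)
    + (∫ x, D.η t x * dt D.T D.G t x * trace Ω φ x ∂surf Ω)
    + (∫ x, D.g t x * trace Ω φ x ∂surf Ω)

/-- `(u, h)` solves the reformulated inverse problem, in the class `h ∈ L²(0,T)`,
`u ∈ C([0,T]; H¹(Ω))`, `∂ₜ u ∈ L²(0,T; H¹(Ω))`. -/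
structure IsSolution (u : ℝ → H1 Ω) (h : ℝ → ℝ) : Prop where
  h_mem : MemL2Time D.T h
  u_cont : ContinuousOn u (Icc 0 D.T)
  u_deriv : HasL2TimeDeriv D.T u
  initial : u 0 = D.u₀
  h_eq : ∀ᵐ t ∂volume.restrict (Ioo 0 D.T), h t = D.hExpr u t
  var_eq : ∀ᵐ t ∂volume.restrict (Ioo 0 D.T), ∀ φ : H1 Ω, D.VarEq u h t φ

end Data

end PseudoParabolic

end

noncomputable section

namespace PseudoParabolic

/-! ### Weak time derivatives and the fundamental theorem of calculus. -/

section WeakDerivative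

variable {X : Type*} [NormedAddCommGroup X] [NormedSpace ℝ X]

/-! Put `U = u₁ - u₂` and let `V` be the difference of the chosen weak time derivatives. In the
difference of the two variational identities the boundary terms cancel, as they depend on the data
alone. The formula for `h` bounds `|h₁ - h₂|` by a multiple of `‖U‖`, because `1/ω` is bounded and
`F` is Lipschitz (`exists_abs_hExpr_sub_le`).

Testing with `φ = V` makes the left side control `‖V‖²` through `(V, V) + (η∇V, ∇V)`; the remaining
terms are at most a constant times `‖U‖ ‖V‖`. Hence `‖V(t)‖ ≤ C ‖U(t)‖` for almost every `t`
(`norm_dt_sub_le`): the equation behaves like an ODE in `H¹(Ω)`.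

Since `U(0) = 0`, integrating in time (`HasWeakTimeDeriv.eq_add_integral`) gives `‖U(t)‖ ≤ C ∫₀ᵗ
‖U‖`, and Grönwall (`eq_zero_of_le_mul_integral`) forces `U = 0`. The bound on `|h₁ - h₂|` then
yields `h₁ = h₂`. -/

/-- Integration by parts for the primitive of an integrable function. -/
lemma integral_deriv_smul_primitive [CompleteSpace X] {T : ℝ} {v : ℝ → X}
    (hv : IntegrableOn v (Ioo 0 T)) {ψ : ℝ → ℝ} (h1 : ContDiff ℝ ∞ ψ) (h2 : HasCompactSupport ψ)
    (h3 : tsupport ψ ⊆ Ioo 0 T) :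
    ∫ t in Ioo 0 T, deriv ψ t • (∫ s in (0 : ℝ)..t, v s) = - ∫ t in Ioo 0 T, ψ t • v t := by
  have hψ' : Continuous (deriv ψ) := h1.continuous_deriv (by simp)
  have hψ'i : IntegrableOn (deriv ψ) (Ioo 0 T) :=
    (hψ'.integrable_of_hasCompactSupport h2.deriv).integrableOn
  -- Fubini on the triangle `s ≤ t`: integrating first in `s` produces the primitive, first in `t`
  -- produces `ψ T - ψ s`, where `ψ T = 0`.
  set f : ℝ → ℝ → X := fun t s => {z : ℝ × ℝ | z.2 ≤ z.1}.indicator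
    (fun z => deriv ψ z.1 • v z.2) (t, s) with hf
  have hfi : Integrable (Function.uncurry f)
      ((volume.restrict (Ioo 0 T)).prod (volume.restrict (Ioo 0 T))) :=
    (Integrable.smul_prod hψ'i hv).indicator (measurableSet_le measurable_snd measurable_fst)
  have e1 : ∀ t ∈ Ioo 0 T, ∫ s in Ioo 0 T, f t s = deriv ψ t • (∫ s in (0 : ℝ)..t, v s) := by
    intro t ht
    have : ∀ s, f t s = (Iic t).indicator (fun s => deriv ψ t • v s) s := fun s => by
      simp only [hf, indicator, mem_Iic, mem_ofPred_eq]
    simp only [this]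
    rw [setIntegral_indicator measurableSet_Iic, integral_smul,
      intervalIntegral.integral_of_le ht.1.le]
    congr 3
    ext s
    simp only [mem_inter_iff, mem_Ioo, mem_Iic, mem_Ioc]
    exact ⟨fun h => ⟨h.1.1, h.2⟩, fun h => ⟨⟨h.1, h.2.trans_lt ht.2⟩, h.2⟩⟩
  have e2 : ∀ s ∈ Ioo 0 T, ∫ t in Ioo 0 T, f t s = -(ψ s • v s) := by
    intro s hs
    have : ∀ t, f t s = (Ici s).indicator (fun t => deriv ψ t • v s) t := fun t => by
      simp only [hf, indicator, mem_Ici, mem_ofPred_eq]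
    simp only [this]
    rw [setIntegral_indicator measurableSet_Ici, integral_smul_const]
    have hset : Ioo 0 T ∩ Ici s = Ico s T := by
      ext t
      simp only [mem_inter_iff, mem_Ioo, mem_Ici, mem_Ico]
      exact ⟨fun h => ⟨h.2, h.1.2⟩, fun h => ⟨⟨hs.1.trans_le h.1, h.2⟩, h.1⟩⟩
    have hT : ψ T = 0 := by
      by_contra h
      exact lt_irrefl _ (h3 (subset_tsupport _ h)).2
    rw [hset, integral_Ico_eq_integral_Ioc, ← intervalIntegral.integral_of_le hs.2.le,
      intervalIntegral.integral_deriv_eq_sub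
        (fun x _ => (h1.differentiable (by simp)).differentiableAt)
        (hψ'.intervalIntegrable _ _), hT, zero_sub, neg_smul]
  rw [← setIntegral_congr_fun measurableSet_Ioo e1, integral_integral_swap hfi,
    setIntegral_congr_fun measurableSet_Ioo e2, integral_neg]

/-- A test function of vanishing integral is the derivative of a test function. -/
lemma exists_testFunction_deriv_eq {T : ℝ} {θ : ℝ → ℝ} (h1 : ContDiff ℝ ∞ θ)
    (h2 : HasCompactSupport θ) (h3 : tsupport θ ⊆ Ioo 0 T) (h0 : ∫ t, θ t = 0) :
    ∃ ψ : ℝ → ℝ, ContDiff ℝ ∞ ψ ∧ HasCompactSupport ψ ∧ tsupport ψ ⊆ Ioo 0 T ∧ deriv ψ = θ := by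
  obtain hne | hne := (tsupport θ).eq_empty_or_nonempty
  · rw [tsupport_eq_empty_iff] at hne
    subst hne
    exact ⟨0, contDiff_const, .zero, by simp [tsupport], by ext; simp⟩
  obtain ⟨a, ha, ha'⟩ := IsCompact.exists_isLeast h2 hne
  obtain ⟨b, hb, hb'⟩ := IsCompact.exists_isGreatest h2 hne
  have hd : ∀ t, HasDerivAt (fun t => ∫ s in (0 : ℝ)..t, θ s) (θ t) t := fun t =>
    intervalIntegral.integral_hasDerivAt_right (h1.continuous.intervalIntegrable _ _)
      (h1.continuous.stronglyMeasurableAtFilter _ _) h1.continuous.continuousAt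
  have hd' : deriv (fun t => ∫ s in (0 : ℝ)..t, θ s) = θ := funext fun t => (hd t).deriv
  have hzero : ∀ s, s ∉ Icc a b → θ s = 0 := fun s hs => by
    by_contra h
    exact hs ⟨ha' (subset_tsupport _ h), hb' (subset_tsupport _ h)⟩
  -- Left of `a` the primitive integrates zero; right of `b` it equals the total integral of `θ`,
  -- which vanishes by `h0`.
  have hsupp : Function.support (fun t => ∫ s in (0 : ℝ)..t, θ s) ⊆ Icc a b := by
    intro t ht
    by_contra hab
    apply ht
    obtain hta | hta := lt_or_ge t a
    · refine (intervalIntegral.integral_congr (g := fun _ => (0 : ℝ)) fun s hs => ?_).trans (by simp)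
      refine hzero s fun h => ?_
      have := hs.2.trans_lt (max_lt (h3 ha).1 hta)
      exact absurd h.1 (not_le.2 this)
    · have htb : b < t := by
        by_contra h
        exact hab ⟨hta, not_lt.1 h⟩
      refine (intervalIntegral.integral_eq_integral_of_support_subset fun s hs => ?_).trans h0
      have hs' := subset_tsupport _ hs
      exact ⟨(h3 hs').1, (hb' hs').trans htb.le⟩
  have hts : tsupport (fun t => ∫ s in (0 : ℝ)..t, θ s) ⊆ Icc a b :=
    closure_minimal hsupp isClosed_Icc
  refine ⟨fun t => ∫ s in (0 : ℝ)..t, θ s, ?_, ?_, ?_, hd'⟩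
  · rw [contDiff_infty_iff_deriv, hd']
    exact ⟨fun t => (hd t).differentiableAt, h1⟩
  · exact isCompact_Icc.of_isClosed_subset (isClosed_tsupport _) hts
  · exact hts.trans (Icc_subset_Ioo (h3 ha).1 (h3 hb).2)

/-- The lemma of du Bois-Reymond: a function with vanishing weak derivative is constant. -/
lemma ae_eq_const_of_integral_deriv_smul_eq_zero [CompleteSpace X] {T : ℝ} (hT : 0 < T)
    {f : ℝ → X} (hf : IntegrableOn f (Ioo 0 T))
    (h : ∀ ψ : ℝ → ℝ, ContDiff ℝ ∞ ψ → HasCompactSupport ψ → tsupport ψ ⊆ Ioo 0 T →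
      ∫ t in Ioo 0 T, deriv ψ t • f t = 0) :
    ∃ c : X, f =ᵐ[volume.restrict (Ioo 0 T)] fun _ => c := by
  let χ : ContDiffBump (T / 2) := ⟨T / 8, T / 4, by positivity, by linarith⟩
  have hχ1 : ContDiff ℝ ∞ (χ.normed volume) := χ.contDiff_normed
  have hχ2 : HasCompactSupport (χ.normed volume) := χ.hasCompactSupport_normed
  have hχ3 : tsupport (χ.normed volume) ⊆ Ioo 0 T := by
    rw [χ.tsupport_normed_eq, Real.closedBall_eq_Icc]
    exact Icc_subset_Ioo (by simp only [χ]; linarith) (by simp only [χ]; linarith)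
  have hint : ∀ φ : ℝ → ℝ, ContDiff ℝ ∞ φ → HasCompactSupport φ →
      IntegrableOn (fun t => φ t • f t) (Ioo 0 T) := fun φ hφ1 hφ2 => by
    obtain ⟨C, hC⟩ := hφ2.exists_bound_of_continuous hφ1.continuous
    exact hf.bdd_smul C hφ1.continuous.aestronglyMeasurable (Filter.Eventually.of_forall hC)
  -- The constant has to be the mean of `f` against a bump of integral one.
  set c : X := ∫ t in Ioo 0 T, χ.normed volume t • f t with hc
  refine ⟨c, ?_⟩
  have key := isOpen_Ioo.ae_eq_zero_of_integral_contDiff_smul_eq_zero (μ := volume.restrict (Ioo 0 T))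
    (U := Ioo 0 T) (f := fun t => f t - c)
    (((hf.sub (integrable_const c)).locallyIntegrable).locallyIntegrableOn _) ?_
  · filter_upwards [key, ae_restrict_mem measurableSet_Ioo] with t ht ht'
    exact sub_eq_zero.1 (ht ht')
  intro φ h1 h2 h3
  have hφi : Integrable φ := h1.continuous.integrable_of_hasCompactSupport h2
  have hχi : Integrable (χ.normed volume) := hχ1.continuous.integrable_of_hasCompactSupport hχ2
  have hφ : ∫ t in Ioo 0 T, φ t = ∫ t, φ t :=
    setIntegral_eq_integral_of_forall_compl_eq_zero fun t ht => by
      by_contra hne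
      exact ht (h3 (subset_tsupport _ hne))
  have hsub : tsupport (fun t => φ t - (∫ t, φ t) * χ.normed volume t) ⊆ Ioo 0 T := by
    refine (closure_minimal ?_ ((isClosed_tsupport φ).union
      (isClosed_tsupport (χ.normed volume)))).trans (union_subset h3 hχ3)
    intro t ht
    by_contra hn
    rw [mem_union, not_or] at hn
    apply ht
    simp [image_eq_zero_of_notMem_tsupport hn.1, image_eq_zero_of_notMem_tsupport hn.2]
  -- Subtracting `(∫ φ) χ` removes the mean of `φ`, so the result is an admissible `deriv ψ`; the
  -- hypothesis then reads `∫ φ • f = (∫ φ) • c`.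
  obtain ⟨ψ, p1, p2, p3, p4⟩ := exists_testFunction_deriv_eq (T := T)
    (θ := fun t => φ t - (∫ t, φ t) * χ.normed volume t)
    (h1.sub (contDiff_const.mul hχ1)) (h2.sub (hχ2.mul_left)) hsub (by
      rw [integral_sub hφi (hχi.const_mul _), integral_const_mul, χ.integral_normed]
      ring)
  have := h ψ p1 p2 p3
  rw [p4] at this
  simp only [sub_smul, mul_smul] at this
  have hχf : IntegrableOn (fun t => (∫ t, φ t) • χ.normed volume t • f t) (Ioo 0 T) :=
    (hint _ hχ1 hχ2).smul _
  rw [integral_sub (hint φ h1 h2) hχf, integral_smul, ← hc] at this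
  simp only [smul_sub]
  rw [integral_sub (hint φ h1 h2) (hφi.integrableOn.smul_const c), integral_smul_const, hφ]
  exact this

/-- The fundamental theorem of calculus for continuous functions with a weak time derivative. -/
lemma HasWeakTimeDeriv.eq_add_integral [CompleteSpace X] {T : ℝ} (hT : 0 < T) {v v' : ℝ → X}
    (hv : ContinuousOn v (Icc 0 T)) (hv' : IntegrableOn v' (Ioo 0 T))
    (h : HasWeakTimeDeriv T v v') {t : ℝ} (ht : t ∈ Icc 0 T) :
    v t = v 0 + ∫ s in (0 : ℝ)..t, v' s := by
  have hw : ContinuousOn (fun t => ∫ s in (0 : ℝ)..t, v' s) (Icc 0 T) :=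
    by
    have := intervalIntegral.continuousOn_primitive_interval (f := v') (μ := volume) (a := 0)
      (b := T) (by rwa [uIcc_of_le hT.le, integrableOn_Icc_iff_integrableOn_Ioo])
    rwa [uIcc_of_le hT.le] at this
  have hvi : IntegrableOn v (Ioo 0 T) := hv.integrableOn_Icc.mono_set Ioo_subset_Icc_self
  have hwi : IntegrableOn (fun t => ∫ s in (0 : ℝ)..t, v' s) (Ioo 0 T) :=
    hw.integrableOn_Icc.mono_set Ioo_subset_Icc_self
  obtain ⟨c, hc⟩ := ae_eq_const_of_integral_deriv_smul_eq_zero hT (hvi.sub hwi) (by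
    intro ψ h1 h2 h3
    have hψ' : Continuous (deriv ψ) := h1.continuous_deriv (by simp)
    obtain ⟨C, hC⟩ := h2.deriv.exists_bound_of_continuous hψ'
    have hb : ∀ {f : ℝ → X}, IntegrableOn f (Ioo 0 T) →
        IntegrableOn (fun t => deriv ψ t • f t) (Ioo 0 T) := fun hf =>
      hf.bdd_smul C hψ'.aestronglyMeasurable (Filter.Eventually.of_forall hC)
    simp only [Pi.sub_apply, smul_sub]
    rw [integral_sub (hb hvi) (hb hwi), h ψ h1 h2 h3, integral_deriv_smul_primitive hv' h1 h2 h3,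
      sub_self])
  -- Continuity upgrades equality almost everywhere to the closed interval, endpoints included;
  -- evaluating at `0` identifies `c` with `v 0`.
  have heq : ∀ s ∈ Icc 0 T, v s - ∫ r in (0 : ℝ)..s, v' r = c :=
    Measure.eqOn_Icc_of_ae_eq volume hT.ne (by
      rw [restrict_Ioo_eq_restrict_Icc.symm]; exact hc) (hv.sub hw) continuousOn_const
  have e0 := heq 0 ⟨le_rfl, hT.le⟩
  rw [intervalIntegral.integral_same, sub_zero] at e0
  rw [e0, ← heq t ht, sub_add_cancel]

lemma dt_spec {T : ℝ} {v : ℝ → X} (h : HasL2TimeDeriv T v) :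
    MemL2Time T (dt T v) ∧ HasWeakTimeDeriv T v (dt T v) := by
  rw [dt, dif_pos h]
  exact h.choose_spec

end WeakDerivative

lemma MemL2Time.integrableOn {X : Type*} [NormedAddCommGroup X] {T : ℝ} {v : ℝ → X} (h : MemL2Time T v) :
    IntegrableOn v (Ioo 0 T) :=
  MemLp.integrable (by norm_num) h

/-- Grönwall's inequality in integral form, with zero initial value. -/
lemma eq_zero_of_le_mul_integral {T C : ℝ} {n : ℝ → ℝ} (hT : 0 ≤ T)
    (hn : ContinuousOn n (Icc 0 T)) (h0 : ∀ t ∈ Icc 0 T, 0 ≤ n t)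
    (h : ∀ t ∈ Icc 0 T, n t ≤ C * ∫ s in (0 : ℝ)..t, n s) : ∀ t ∈ Icc 0 T, n t = 0 := by
  have hi : ∀ t ∈ Icc 0 T, IntervalIntegrable n volume 0 t := fun t ht =>
    (hn.mono (by rw [uIcc_of_le ht.1]; exact Icc_subset_Icc_right ht.2)).intervalIntegrable
  have hpos : ∀ t ∈ Icc 0 T, 0 ≤ ∫ s in (0 : ℝ)..t, n s := fun t ht =>
    intervalIntegral.integral_nonneg ht.1 fun s hs => h0 s ⟨hs.1, hs.2.trans ht.2⟩
  have hcont : ContinuousOn (fun t => ∫ s in (0 : ℝ)..t, n s) (Icc 0 T) := by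
    have := intervalIntegral.continuousOn_primitive_interval (f := n) (μ := volume) (a := 0)
      (b := T) (by rw [uIcc_of_le hT]; exact hn.integrableOn_Icc)
    rwa [uIcc_of_le hT] at this
  -- The differential form is applied to the primitive of `n`: its right derivative is `n`, which
  -- `h` bounds by `C` times the primitive.
  have key := norm_le_gronwallBound_of_norm_deriv_right_le (f := fun t => ∫ s in (0 : ℝ)..t, n s)
    (f' := n) (δ := 0) (K := C) (ε := 0) (a := 0) (b := T)
    hcont (fun t ht => by
      have hc : ContinuousWithinAt n (Ioi t) t :=
        ((hn t (Ico_subset_Icc_self ht)).mono_of_mem_nhdsWithin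
          (Filter.mem_of_superset (Ioc_mem_nhdsGT ht.2) fun s hs => ⟨ht.1.trans hs.1.le, hs.2⟩))
      refine intervalIntegral.integral_hasDerivWithinAt_right (hi t (Ico_subset_Icc_self ht))
        (t := Ioi t) ⟨Ioc t T, Ioc_mem_nhdsGT ht.2, ?_⟩ hc
      exact (hn.mono fun s hs => ⟨ht.1.trans hs.1.le, hs.2⟩).aestronglyMeasurable
        measurableSet_Ioc) (by simp) (fun t ht => by
      have ht' := Ico_subset_Icc_self ht
      rw [Real.norm_of_nonneg (h0 t ht'), Real.norm_of_nonneg (hpos t ht'), add_zero]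
      exact h t ht')
  intro t ht
  have := key t ht
  rw [gronwallBound_ε0_δ0] at this
  have hz := norm_le_zero_iff.1 this
  refine le_antisymm ?_ (h0 t ht)
  have := h t ht
  rwa [hz, mul_zero] at this

variable {d : ℕ}

/-! ### Multiplication and superposition in `L²`. -/

section L2

variable {α : Type*} [MeasurableSpace α] {μ : Measure α}

/-- The witness is the product `c • f`. Integrability is included because splitting the coefficient
integrals by linearity needs it. -/
lemma exists_Lp_ae_eq_smul {F : Type*} [NormedAddCommGroup F] [InnerProductSpace ℝ F] {c : α → ℝ}
    {C : ℝ} (hc : AEStronglyMeasurable c μ) (hC : ∀ᵐ x ∂μ, |c x| ≤ C) (f : Lp F 2 μ) :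
    ∃ k : Lp F 2 μ, ‖k‖ ≤ C * ‖f‖ ∧ ∀ g : Lp F 2 μ, ∫ x, c x * inner ℝ (f x) (g x) ∂μ = inner ℝ k g ∧
      Integrable (fun x => c x * inner ℝ (f x) (g x)) μ := by
  have hb : ∀ᵐ x ∂μ, ‖c x • f x‖ ≤ C * ‖f x‖ := by
    filter_upwards [hC] with x hx
    rw [norm_smul]
    exact mul_le_mul_of_nonneg_right hx (norm_nonneg _)
  have hm : MemLp (fun x => c x • f x) 2 μ :=
    (Lp.memLp f).of_le_mul (hc.smul (Lp.aestronglyMeasurable f)) hb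
  refine ⟨hm.toLp _, Lp.norm_le_mul_norm_of_ae_le_mul ?_, fun g => ?_⟩
  · filter_upwards [hb, hm.coeFn_toLp] with x hx hx'
    rwa [hx']
  · have : (fun x => c x * inner ℝ (f x) (g x)) =ᵐ[μ] fun x => inner ℝ (hm.toLp _ x) (g x) := by
      filter_upwards [hm.coeFn_toLp] with x hx
      rw [hx, real_inner_smul_left]
    exact ⟨(integral_congr_ae this).trans (L2.inner_def _ _).symm,
      (L2.integrable_inner _ _).congr this.symm⟩

lemma integral_mul_eq_inner (f g : Lp ℝ 2 μ) : ∫ x, f x * g x ∂μ = inner ℝ f g := by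
  rw [L2.inner_def]
  exact integral_congr_ae (Filter.Eventually.of_forall fun x => by simp [mul_comm])

lemma integral_eq_inner_const [IsFiniteMeasure μ] (f : Lp ℝ 2 μ) :
    ∫ x, f x ∂μ = inner ℝ (Lp.const 2 μ (1 : ℝ)) f := by
  rw [← integral_mul_eq_inner]
  refine integral_congr_ae ?_
  filter_upwards [Lp.coeFn_const (p := 2) (μ := μ) (1 : ℝ)] with x hx
  rw [hx, Function.const_apply, one_mul]

/-- Superposition with a Lipschitz function, as a map of `L²`. -/
lemma exists_superposition [IsFiniteMeasure μ] {F : ℝ → ℝ} {L : NNReal} (hF : LipschitzWith L F) :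
    ∃ N : Lp ℝ 2 μ → Lp ℝ 2 μ, (∀ f, N f =ᵐ[μ] fun x => F (f x)) ∧
      ∀ f g, ‖N f - N g‖ ≤ L * ‖f - g‖ := by
  have hm : ∀ f : Lp ℝ 2 μ, MemLp (fun x => F (f x)) 2 μ := fun f => by
    -- `F ∘ f - F 0` is dominated by `L |f|`; the constant `F 0` is in `L²` because the measure is
    -- finite.
    have h1 : MemLp (fun x => F (f x) - F 0) 2 μ := by
      refine (Lp.memLp f).of_le_mul (c := L) ?_ (Filter.Eventually.of_forall fun x => ?_)
      · exact (hF.continuous.comp_aestronglyMeasurable (Lp.aestronglyMeasurable f)).sub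
          aestronglyMeasurable_const
      · simpa using hF.norm_sub_le (f x) 0
    refine (h1.add (memLp_const (F 0))).ae_eq (Filter.Eventually.of_forall fun x => ?_)
    exact sub_add_cancel _ _
  refine ⟨fun f => (hm f).toLp _, fun f => (hm f).coeFn_toLp, fun f g =>
    Lp.norm_le_mul_norm_of_ae_le_mul ?_⟩
  filter_upwards [(hm f).coeFn_toLp, (hm g).coeFn_toLp, Lp.coeFn_sub ((hm f).toLp _)
    ((hm g).toLp _), Lp.coeFn_sub f g] with x h1 h2 h3 h4
  rw [h3, h4, Pi.sub_apply, Pi.sub_apply, h1, h2]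
  exact hF.norm_sub_le _ _

end L2

/-! ### Norms in `H¹(Ω)`. -/

section H1

variable {Ω : Set (E d)}

lemma fn_sub (v w : H1 Ω) : fn (v - w) = fn v - fn w := rfl

lemma grad_sub (v w : H1 Ω) : grad (v - w) = grad v - grad w := rfl

lemma norm_sq_eq (v : H1 Ω) : ‖v‖ ^ 2 = ‖fn v‖ ^ 2 + ‖grad v‖ ^ 2 :=
  WithLp.prod_norm_sq_eq_of_L2 v.1

lemma norm_fn_le (v : H1 Ω) : ‖fn v‖ ≤ ‖v‖ := by
  refine le_of_sq_le_sq ?_ (norm_nonneg _)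
  rw [norm_sq_eq v]
  exact le_add_of_nonneg_right (sq_nonneg _)

lemma norm_grad_le (v : H1 Ω) : ‖grad v‖ ≤ ‖v‖ := by
  refine le_of_sq_le_sq ?_ (norm_nonneg _)
  rw [norm_sq_eq v]
  exact le_add_of_nonneg_left (sq_nonneg _)

end H1

/-! ### Energy estimate and bound for `h`. -/

namespace Data

variable {Ω : Set (E d)} {D : Data Ω}

/-- Subtracting the variational identities of two solutions, tested with the difference of the
time derivatives, bounds that difference by the difference of the solutions. -/
lemma norm_dt_sub_le [IsFiniteMeasure (vol Ω)] {η₀ η₁ κ₁ P R : ℝ} {L : NNReal} (hη₀ : 0 < η₀)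
    (hF : LipschitzWith L D.F) {u₁ u₂ : ℝ → H1 Ω} {h₁ h₂ : ℝ → ℝ} {t : ℝ}
    (hη_meas : AEStronglyMeasurable (D.η t) (vol Ω))
    (hη : ∀ᵐ x ∂vol Ω, η₀ ≤ D.η t x ∧ D.η t x ≤ η₁)
    (hκ_meas : AEStronglyMeasurable (D.κ t) (vol Ω)) (hκ : ∀ᵐ x ∂vol Ω, |D.κ t x| ≤ κ₁)
    (hκ₁ : 0 ≤ κ₁) (hP : ‖D.p t‖ ≤ P) (hh : |h₁ t - h₂ t| ≤ R * ‖u₁ t - u₂ t‖) (hR : 0 ≤ R)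
    (hv₁ : ∀ φ, D.VarEq u₁ h₁ t φ) (hv₂ : ∀ φ, D.VarEq u₂ h₂ t φ) :
    ‖dt D.T u₁ t - dt D.T u₂ t‖ ≤ (κ₁ + R * P + L) / min 1 η₀ * ‖u₁ t - u₂ t‖ := by
  set V := dt D.T u₁ t - dt D.T u₂ t with hV
  set U := u₁ t - u₂ t with hU
  obtain ⟨N, hN, hNL⟩ := exists_superposition (μ := vol Ω) hF
  have hηabs : ∀ᵐ x ∂vol Ω, |D.η t x| ≤ η₁ := by
    filter_upwards [hη] with x hx
    rw [abs_of_pos (hη₀.trans_le hx.1)]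
    exact hx.2
  obtain ⟨a₁, -, ha₁⟩ := exists_Lp_ae_eq_smul hη_meas hηabs (grad (dt D.T u₁ t))
  obtain ⟨a₂, -, ha₂⟩ := exists_Lp_ae_eq_smul hη_meas hηabs (grad (dt D.T u₂ t))
  obtain ⟨a, -, ha⟩ := exists_Lp_ae_eq_smul hη_meas hηabs (grad V)
  obtain ⟨b₁, -, hb₁⟩ := exists_Lp_ae_eq_smul hκ_meas hκ (grad (u₁ t))
  obtain ⟨b₂, -, hb₂⟩ := exists_Lp_ae_eq_smul hκ_meas hκ (grad (u₂ t))
  obtain ⟨b, hbn, hb⟩ := exists_Lp_ae_eq_smul hκ_meas hκ (grad U)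
  have hlin : ∀ {c : E d → ℝ} {f g : Lp (E d) 2 (vol Ω)} {w : Lp (E d) 2 (vol Ω)},
      Integrable (fun x => c x * inner ℝ (f x) (w x)) (vol Ω) →
      Integrable (fun x => c x * inner ℝ (g x) (w x)) (vol Ω) →
      ∫ x in Ω, c x * inner ℝ ((f - g) x) (w x) = (∫ x in Ω, c x * inner ℝ (f x) (w x)) -
        ∫ x in Ω, c x * inner ℝ (g x) (w x) := fun {c f g w} hf hg => by
    rw [← integral_sub hf hg]
    refine integral_congr_ae ?_
    filter_upwards [Lp.coeFn_sub f g] with x hx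
    rw [hx, Pi.sub_apply, inner_sub_left, mul_sub]
  have eη := hlin (ha₁ (grad V)).2 (ha₂ (grad V)).2
  have eκ := hlin (hb₁ (grad V)).2 (hb₂ (grad V)).2
  rw [← grad_sub, ← hV] at eη
  rw [← grad_sub, ← hU, (hb (grad V)).1] at eκ
  have hNint : ∀ f : Lp ℝ 2 (vol Ω), ∫ x in Ω, D.F (f x) * fn V x = inner ℝ (N f) (fn V) :=
    fun f => by
      rw [← integral_mul_eq_inner]
      refine integral_congr_ae ?_
      filter_upwards [hN f] with x hx
      rw [hx]
  have v₁ := hv₁ V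
  have v₂ := hv₂ V
  -- The boundary integrals are literally the same in `v₁` and `v₂`, so they drop out on
  -- subtraction.
  simp only [VarEq, hNint, integral_mul_eq_inner] at v₁ v₂
  have efn : inner ℝ (fn (dt D.T u₁ t)) (fn V) - inner ℝ (fn (dt D.T u₂ t)) (fn V) =
      ‖fn V‖ ^ 2 := by
    rw [← inner_sub_left, ← fn_sub, ← hV, real_inner_self_eq_norm_sq]
  have eN : inner ℝ (N (fn (u₁ t))) (fn V) - inner ℝ (N (fn (u₂ t))) (fn V) =
      inner ℝ (N (fn (u₁ t)) - N (fn (u₂ t))) (fn V) := (inner_sub_left _ _ _).symm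
  have hηlow : η₀ * ‖grad V‖ ^ 2 ≤ ∫ x in Ω, D.η t x * inner ℝ (grad V x) (grad V x) := by
    rw [← real_inner_self_eq_norm_sq, L2.inner_def, ← integral_const_mul]
    refine integral_mono_ae ((L2.integrable_inner _ _).const_mul _) (ha (grad V)).2 ?_
    filter_upwards [hη] with x hx
    exact mul_le_mul_of_nonneg_right hx.1 real_inner_self_nonneg
  have hκup : -inner ℝ b (grad V) ≤ κ₁ * ‖U‖ * ‖V‖ := by
    refine (neg_le_abs _).trans ((abs_real_inner_le_norm _ _).trans ?_)
    refine mul_le_mul (hbn.trans ?_) (norm_grad_le V) (norm_nonneg _) (by positivity)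
    exact mul_le_mul_of_nonneg_left (norm_grad_le U) hκ₁
  have hpup : (h₁ t - h₂ t) * inner ℝ (D.p t) (fn V) ≤ (R * ‖U‖) * (P * ‖V‖) := by
    refine (le_abs_self _).trans ?_
    rw [abs_mul]
    refine mul_le_mul hh ((abs_real_inner_le_norm _ _).trans ?_) (abs_nonneg _) (by positivity)
    exact mul_le_mul hP (norm_fn_le V) (norm_nonneg _) ((norm_nonneg _).trans hP)
  have hNup : inner ℝ (N (fn (u₁ t)) - N (fn (u₂ t))) (fn V) ≤ L * ‖U‖ * ‖V‖ := by
    refine (real_inner_le_norm _ _).trans ?_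
    refine mul_le_mul ((hNL _ _).trans ?_) (norm_fn_le V) (norm_nonneg _) (by positivity)
    rw [← fn_sub, ← hU]
    exact mul_le_mul_of_nonneg_left (norm_fn_le U) L.2
  have hm : 0 < min 1 η₀ := lt_min one_pos hη₀
  -- Coercivity in the full `H¹` norm: `1` comes from the `L²` term, `η₀` from the gradient term.
  have hlow : min 1 η₀ * ‖V‖ ^ 2 ≤ ‖fn V‖ ^ 2 + η₀ * ‖grad V‖ ^ 2 := by
    rw [norm_sq_eq, mul_add]
    exact add_le_add ((mul_le_mul_of_nonneg_right (min_le_left _ _) (sq_nonneg _)).trans_eq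
      (one_mul _)) (mul_le_mul_of_nonneg_right (min_le_right _ _) (sq_nonneg _))
  have hfinal : (min 1 η₀ * ‖V‖) * ‖V‖ ≤ ((κ₁ + R * P + L) * ‖U‖) * ‖V‖ := by
    linarith
  rw [div_mul_eq_mul_div, le_div_iff₀ hm, mul_comm]
  obtain hV0 | hV0 := (norm_nonneg V).eq_or_lt
  · rw [← hV0, mul_zero]
    have := (norm_nonneg _).trans hP
    positivity
  · exact le_of_mul_le_mul_right hfinal hV0

/-- `h(t)` depends Lipschitz continuously on `u(t)`, uniformly in time. -/
lemma exists_abs_hExpr_sub_le [IsFiniteMeasure (vol Ω)] (hD : D.Admissible) :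
    ∃ R : ℝ, 0 ≤ R ∧ ∀ t ∈ Icc 0 D.T, ∀ u₁ u₂ : ℝ → H1 Ω,
      |D.hExpr u₁ t - D.hExpr u₂ t| ≤ R * ‖u₁ t - u₂ t‖ := by
  obtain ⟨L, hF⟩ := hD.F_lip
  obtain ⟨N, hN, hNL⟩ := exists_superposition (μ := vol Ω) hF
  -- `ω` is the inner product of `p` with the constant `1`, hence continuous; having no zero on a
  -- compact interval, it has a bounded reciprocal.
  have hω : ContinuousOn (fun t => 1 / D.omega t) (Icc 0 D.T) := by
    refine continuousOn_const.div ?_ hD.omega_ne_zero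
    exact (continuousOn_const.inner hD.p_cont).congr fun t _ => integral_eq_inner_const (D.p t)
  obtain ⟨B, hB⟩ := isCompact_Icc.exists_bound_of_continuousOn hω
  have hB0 : 0 ≤ B := (norm_nonneg _).trans (hB 0 ⟨le_rfl, hD.T_pos.le⟩)
  refine ⟨B * (‖Lp.const 2 (vol Ω) (1 : ℝ)‖ * L), by positivity, fun t ht u₁ u₂ => ?_⟩
  have hint : ∀ f : Lp ℝ 2 (vol Ω), ∫ x in Ω, D.F (f x) =
      inner ℝ (Lp.const 2 (vol Ω) (1 : ℝ)) (N f) := fun f => by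
    rw [← integral_eq_inner_const]
    exact (integral_congr_ae (hN f)).symm
  -- Only the `F` term of the formula depends on the solution.
  have e : D.hExpr u₁ t - D.hExpr u₂ t = 1 / D.omega t *
      inner ℝ (Lp.const 2 (vol Ω) (1 : ℝ)) (N (fn (u₂ t)) - N (fn (u₁ t))) := by
    simp only [hExpr, hint, inner_sub_right]
    ring
  rw [e, abs_mul, mul_assoc, mul_assoc]
  refine mul_le_mul (hB t ht) ((abs_real_inner_le_norm _ _).trans ?_) (abs_nonneg _) hB0
  refine mul_le_mul_of_nonneg_left ?_ (norm_nonneg _)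
  rw [norm_sub_rev]
  refine (hNL _ _).trans (mul_le_mul_of_nonneg_left ?_ L.2)
  rw [← fn_sub]
  exact norm_fn_le _

end Data

end PseudoParabolic

end

/-! ### Uniqueness. -/

open PseudoParabolic in
theorem mainTheorem2 (d : ℕ) (hd : 1 ≤ d) (Ω : Set (PseudoParabolic.E d))
    (hΩ_open : IsOpen Ω) (hΩ_bdd : Bornology.IsBounded Ω)
    (hΩ_lip : PseudoParabolic.HasLipschitzBoundary Ω)
    (D : PseudoParabolic.Data Ω) (hD : D.Admissible)
    (u₁ u₂ : ℝ → PseudoParabolic.H1 Ω) (h₁ h₂ : ℝ → ℝ)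
    (hsol₁ : D.IsSolution u₁ h₁) (hsol₂ : D.IsSolution u₂ h₂) :
    (∀ t ∈ Set.Icc 0 D.T, u₁ t = u₂ t) ∧
      (∀ᵐ t ∂MeasureTheory.volume.restrict (Set.Ioo 0 D.T), h₁ t = h₂ t) := by
  have hfin : IsFiniteMeasure (vol Ω) := ⟨by
    rw [Measure.restrict_apply_univ]; exact hΩ_bdd.measure_lt_top⟩
  obtain ⟨R, hR, hRh⟩ := Data.exists_abs_hExpr_sub_le hD
  have hhle : ∀ᵐ t ∂volume.restrict (Ioo 0 D.T), |h₁ t - h₂ t| ≤ R * ‖u₁ t - u₂ t‖ := by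
    filter_upwards [hsol₁.h_eq, hsol₂.h_eq, ae_restrict_mem measurableSet_Ioo] with t e₁ e₂ ht
    rw [e₁, e₂]
    exact hRh t (Ioo_subset_Icc_self ht) u₁ u₂
  suffices hu : ∀ t ∈ Icc 0 D.T, u₁ t = u₂ t by
    refine ⟨hu, ?_⟩
    filter_upwards [hhle, ae_restrict_mem measurableSet_Ioo] with t ht ht'
    rw [hu t (Ioo_subset_Icc_self ht'), sub_self, norm_zero, mul_zero] at ht
    exact sub_eq_zero.1 (abs_nonpos_iff.1 ht)
  obtain ⟨L, hF⟩ := hD.F_lip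
  obtain ⟨η₀, η₁, hη₀, hη⟩ := hD.η_bound
  obtain ⟨κ₀, κ₁, hκ₀, hκ, -⟩ := hD.κ_bound
  obtain ⟨P, hP⟩ := isCompact_Icc.exists_bound_of_continuousOn hD.p_cont
  have hIoo : ∀ {q : ℝ → Prop}, (∀ᵐ t ∂volume.restrict (Icc 0 D.T), q t) →
      ∀ᵐ t ∂volume.restrict (Ioo 0 D.T), q t := fun h =>
    ae_restrict_of_ae_restrict_of_subset Ioo_subset_Icc_self h
  -- The bound on `κ` holds only almost everywhere and is vacuous for empty `Ω`, so `κ₁` could be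
  -- negative; hence `max κ₁ 0`.
  set C := (max κ₁ 0 + R * P + L) / min 1 η₀ with hC
  have hle : ∀ᵐ t ∂volume.restrict (Ioo 0 D.T),
      ‖dt D.T u₁ t - dt D.T u₂ t‖ ≤ C * ‖u₁ t - u₂ t‖ := by
    -- Measurability and bounds on the cylinder pass to almost every time slice by Fubini.
    filter_upwards [hhle, ae_restrict_mem measurableSet_Ioo, hsol₁.var_eq, hsol₂.var_eq,
      hIoo hD.η_meas.prodMk_left, hIoo hD.κ_meas.prodMk_left,
      hIoo (Measure.ae_ae_of_ae_prod hκ)] with t hht ht hv₁ hv₂ hηm hκm hκt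
    have ht' := Ioo_subset_Icc_self ht
    refine Data.norm_dt_sub_le (η₁ := η₁) hη₀ hF hηm ?_ hκm ?_ (le_max_right _ _) (hP t ht') hht hR
      hv₁ hv₂
    · filter_upwards [ae_restrict_mem hΩ_open.measurableSet] with x hx
      exact hη t ht' x (subset_closure hx)
    · filter_upwards [hκt] with x hx
      rw [abs_of_pos (hκ₀.trans_le hx.1)]
      exact hx.2.trans (le_max_left _ _)
  have hu₁ := dt_spec hsol₁.u_deriv
  have hu₂ := dt_spec hsol₂.u_deriv
  have hcont : ContinuousOn (fun t => ‖u₁ t - u₂ t‖) (Icc 0 D.T) :=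
    (hsol₁.u_cont.sub hsol₂.u_cont).norm
  have hzero := eq_zero_of_le_mul_integral (C := C) hD.T_pos.le hcont (fun _ _ => norm_nonneg _) ?_
  · exact fun t ht => sub_eq_zero.1 (norm_eq_zero.1 (hzero t ht))
  intro t ht
  have hmono : ∀ {f : ℝ → H1 Ω}, IntegrableOn f (Ioo 0 D.T) → IntervalIntegrable f volume 0 t :=
    fun hf => (intervalIntegrable_iff_integrableOn_Ioo_of_le ht.1).2
      (hf.mono_set (Ioo_subset_Ioo_right ht.2))
  -- The common initial value cancels, leaving the integral of the difference of the time
  -- derivatives.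
  rw [hu₁.2.eq_add_integral hD.T_pos hsol₁.u_cont hu₁.1.integrableOn ht,
    hu₂.2.eq_add_integral hD.T_pos hsol₂.u_cont hu₂.1.integrableOn ht, hsol₁.initial,
    hsol₂.initial, add_sub_add_left_eq_sub, ← intervalIntegral.integral_sub
      (hmono hu₁.1.integrableOn) (hmono hu₂.1.integrableOn),
    ← intervalIntegral.integral_const_mul]
  refine intervalIntegral.norm_integral_le_of_norm_le ht.1 ?_ ?_
  · rw [← ae_restrict_iff' measurableSet_Ioc, ← restrict_Ioo_eq_restrict_Ioc]
    exact ae_restrict_of_ae_restrict_of_subset (Ioo_subset_Ioo_right ht.2) hle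
  · refine (ContinuousOn.intervalIntegrable ?_).const_mul C
    rw [uIcc_of_le ht.1]
    exact hcont.mono (Icc_subset_Icc_right ht.2)
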